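/- Let $F$ be a non-archimedean local field of characteristic zero with ring of integers $\mathcal{O}$ and uniformizer $\varpi$. Let $G=\mathrm{PGL}(3,F)$, and let $K=\mathrm{PGL}(3,\mathcal{O})\subset G$. Then $G/K$ is the set of vertices of the Bruhat–Tits building of $G$. Let $d$ be the natural ($G$-invariant, Euclidean on apartments) metric of the building, normalized so that adjacent vertices have distance $1$. Let $\mathfrak{a}=\{x\in\mathbb{R}^3: x_1+x_2+x_3=0\}$, let $p:\mathbb{R}^3\to\mathfrak{a}$ be the orthogonal projection, and let $\Lambda=p(\mathbb{Z}^3)$. For vertices $x=gK$ and $y=hK$, the Weyl chamber-valued distance $d_{A^+}(x,y)\in\Lambda$ is the unique point $p(\lambda)$ with $\lambda\in\mathbb{Z}^3$, $\lambda_1\ge\lambda_2\ge\lambda_3$ and $g^{-1}h\in K\,\mathrm{diag}(\varpi^{\lambda_1},\varpi^{\lambda_2},\varpi^{\lambda_3})\,K$. For a polytope $Q\subset\mathfrak{a}$ and a real number $t\ge 0$ put $Q_t=tQ$, $Q_t^\Lambda=Q_t\cap\Lambda$, $|v|_Q=\inf\{t\ge 0: v\in Q_t\}$ and $|v|_Q^{\mathrm{ceil}}=\lceil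 |v|_Q\rceil$. Let $$P=\mathrm{conv}\{(0,0,0),(\tfrac43,-\tfrac23,-\tfrac23),(\tfrac13,\tfrac13,-\tfrac23)\},$$ $$H=\mathrm{conv}\{(0,0,0),(2,-1,-1),(2,0,-2),(1,1,-2)\}.$$ For a vertex $x$ and an integer $m\ge 0$ let $xE_m=\{w\in G/K: d_{A^+}(x,w)\in P_m^\Lambda\}$ be the $P_m$-shaped ball at $x$. Let $E_m$ be the ball at $x=1K$, and let $\tilde E_m\subset G$ be its preimage under $G\to G/K$. (1) For all vertices $x,y\in G/K$ and all integers $m\ge 0$, $$xE_m\cap yE_m\neq\emptyset\iff d_{A^+}(x,y)\in H_m^\Lambda ,\qquad\text{and}\qquad xE_m\cap yE_m\neq\emptyset\iff |d_{A^+}(x,y)|_H^{\mathrm{ceil}}\le m .$$ (2) Let $\Gamma$ be a subgroup of $G$ (in particular, any torsionfree lattice), let $a:\Gamma\backslash G/K\to\mathbb{C}$ be a function (in particular, any bounded one), regarded also as a $(\Gamma,K)$-invariant function on $G$, let $M\ge 1$ be an integer, and put $$\mathcal{L}_M(z,w)=\frac1M\sum_{m=1}^M\frac{1}{\mathrm{card}(E_m)}\int_{z\tilde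 E_m\cap w\tilde E_m}a(u)\,du\qquad(z,w\in G),$$ where $du$ is the Haar measure on $G$ that gives $K$ measure $1$. Then $\mathcal{L}_M(z,w)=0$ whenever $d(zK,wK)>2\sqrt3\,M$. -/

import Mathlib

open scoped Pointwise MatrixGroups ValuativeRel
open MeasureTheory

noncomputable section

namespace PolytopalBalls

/-! ### Euclidean data: the plane, the weight lattice, the Weyl chamber, polytopes -/

/-- Euclidean three-space. -/
abbrev E3 : Type := EuclideanSpace ℝ (Fin 3)

/-- The plane `𝔞` of vectors whose coordinates sum to zero. -/
def 𝔞 : Submodule ℝ E3 where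
  carrier := {x | ∑ i, x i = 0}
  add_mem' := by
    intro x y hx hy
    simp only [Set.mem_ofPred_eq, PiLp.add_apply, Finset.sum_add_distrib] at hx hy ⊢
    rw [hx, hy, add_zero]
  zero_mem' := by simp
  smul_mem' := by
    intro c x hx
    simp only [Set.mem_ofPred_eq, PiLp.smul_apply, smul_eq_mul, ← Finset.mul_sum] at hx ⊢
    rw [hx, mul_zero]

/-- The orthogonal projection onto `𝔞` of an integral vector. -/
def latticePt (l : Fin 3 → ℤ) : E3 :=
  𝔞.starProjection (WithLp.toLp 2 fun i => (l i : ℝ))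

/-- The lattice `Λ ⊂ 𝔞`: the image of `ℤ³` under the orthogonal projection onto `𝔞`. -/
def Lam : Set E3 := Set.range latticePt

/-- `Q_m^Λ`: the lattice points of the `m`-th dilate of `Q`. -/
def dilateLattice (Q : Set E3) (m : ℝ) : Set E3 := (m • Q) ∩ Lam

/-- The polytopal norm `|v|_Q = inf {t ≥ 0 : v ∈ t Q}`. -/
def polytopalNorm (Q : Set E3) (v : E3) : ℝ := sInf {t : ℝ | 0 ≤ t ∧ v ∈ t • Q}

/-- The ceiling of the polytopal norm. -/
def polytopalNormCeil (Q : Set E3) (v : E3) : ℤ := ⌈polytopalNorm Q v⌉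

/-- The triangle `P` in the closed Weyl chamber; its vertex `p† = (4/3, -2/3, -2/3)` is the unique
point of `P` that maximizes the pairing with `δ = (1, 0, -1)`. -/
def polytopeP : Set E3 :=
  convexHull ℝ {!₂[0, 0, 0], !₂[4 / 3, -2 / 3, -2 / 3], !₂[1 / 3, 1 / 3, -2 / 3]}

/-- The quadrilateral `H` in the closed Weyl chamber: its orbit under permutations of the
coordinates is the regular hexagon spanned by the permutations of `(2, 0, -2)`. -/
def polytopeH : Set E3 :=
  convexHull ℝ {!₂[0, 0, 0], !₂[2, -1, -1], !₂[2, 0, -2], !₂[1, 1, -2]}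

/-! ### The group `PGL(3, F)` -/

section Group

variable (F : Type*) [Field F]

/-- The group `G = PGL(3, F)`. -/
abbrev G : Type _ := Matrix.ProjGenLinGroup (Fin 3) F

/-- The quotient topology on `PGL(3, F)` coming from `GL(3, F)`. -/
instance topG [TopologicalSpace F] : TopologicalSpace (G F) :=
  TopologicalSpace.coinduced (Matrix.ProjGenLinGroup.mk : GL (Fin 3) F → G F) inferInstance

/-- The Borel σ-algebra on `PGL(3, F)`. -/
instance measG [TopologicalSpace F] : MeasurableSpace (G F) := borel _

instance borelG [TopologicalSpace F] : BorelSpace (G F) := ⟨rfl⟩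

variable [ValuativeRel F]

/-- The subgroup `K = PGL(3, 𝒪)` of `PGL(3, F)`: the image of `GL(3, 𝒪)`. -/
def K : Subgroup (G F) :=
  ((Matrix.ProjGenLinGroup.mk : GL (Fin 3) F →* G F).comp
    (Matrix.GeneralLinearGroup.map (algebraMap 𝒪[F] F))).range

/-- The vertices of the building of `PGL(3, F)`. -/
abbrev Vertex : Type _ := G F ⧸ K F

variable {F}

/-- `ϖ` is a uniformizer of the ring of integers of `F`. -/
def IsUniformizer (ϖ : Fˣ) : Prop := ∃ π : 𝒪[F], Irreducible π ∧ (π : F) = ϖ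

/-- The class in `PGL(3, F)` of the diagonal matrix with entries `ϖ ^ l i`. These classes form the
group `A`; two tuples `l` give the same class if and only if they differ by a constant, so `A` is
identified with the lattice `Λ` through `latticePt`. -/
def torusElt {F : Type*} [Field F] (ϖ : Fˣ) (l : Fin 3 → ℤ) : G F :=
  Matrix.ProjGenLinGroup.mk
    (Units.map (Matrix.diagonalRingHom (Fin 3) F).toMonoidHom
      (MulEquiv.piUnits.symm fun i => ϖ ^ l i))

/-- The relation saying that the pair of vertices `(x, y)` has Weyl chamber-valued distance `v`:
writing `x = gK` and `y = hK`, the element `g⁻¹ h` lies in `K ϖ^l K` with `l` weakly decreasing, and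
`v` is the point of `Λ⁺` corresponding to `l`. -/
def HasRelPos (ϖ : Fˣ) (x y : Vertex F) (v : E3) : Prop :=
  ∃ l : Fin 3 → ℤ, Antitone l ∧ latticePt l = v ∧
    ∃ g h : G F, (g : Vertex F) = x ∧ (h : Vertex F) = y ∧
      ∃ k₁ ∈ K F, ∃ k₂ ∈ K F, g⁻¹ * h = k₁ * torusElt ϖ l * k₂

/-- The Weyl chamber-valued metric `d_{A⁺}(x, y)`, as a point of `Λ⁺`: the point `v`, which exists and
is unique by the Cartan decomposition, such that `(x, y)` has relative position `v`. -/
def dAplus (ϖ : Fˣ) (x y : Vertex F) : E3 := Classical.epsilon (HasRelPos ϖ x y)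

/-- The `Q`-shaped ball at the vertex `x`. -/
def polytopalBall (ϖ : Fˣ) (Q : Set E3) (x : Vertex F) : Set (Vertex F) :=
  {w | dAplus ϖ x w ∈ Q ∩ Lam}

/-- The ball `x E_m`: the ball at `x` whose shape is the `m`-th dilate of `P`. -/
def ballE (ϖ : Fˣ) (m : ℕ) (x : Vertex F) : Set (Vertex F) :=
  polytopalBall ϖ ((m : ℝ) • polytopeP) x

/-- The preimage in `G` of `E_m`, the ball centred at the vertex `1K`. -/
def ballETilde (ϖ : Fˣ) (m : ℕ) : Set (G F) :=
  (fun g : G F => (g : Vertex F)) ⁻¹' ballE ϖ m ((1 : G F) : Vertex F)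

/-- The natural metric of the building, on vertices. The apartments of the building are the
translates by `g ∈ G` of the standard one, whose vertices are the `ϖ^l K`; the latter is the
Euclidean plane `𝔞` with `ϖ^l K` placed at `latticePt l`, rescaled by `√(3/2)` so that adjacent
vertices have distance 1. Any two vertices lie in a common apartment, and their distance is their
Euclidean distance there (the same for every apartment containing both). -/
def vertexDist (ϖ : Fˣ) (x y : Vertex F) : ℝ :=
  sInf {r : ℝ | ∃ (g : G F) (l l' : Fin 3 → ℤ),
    ((g * torusElt ϖ l : G F) : Vertex F) = x ∧ ((g * torusElt ϖ l' : G F) : Vertex F) = y ∧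
      r = √(3 / 2) * dist (latticePt l) (latticePt l')}

/-- The kernel `L_M(z, w) = (1/M) ∑_{m=1}^M (1/card E_m) ∫_{z Ẽ_m ∩ w Ẽ_m} a(u) du` on `G × G`
associated with a function `a` on `Γ \ G / K`. -/
def kernelL [TopologicalSpace F] (ϖ : Fˣ) (μ : Measure (G F)) (Γ : Subgroup (G F))
    (a : DoubleCoset.Quotient (Γ : Set (G F)) (K F : Set (G F)) → ℂ) (M : ℕ) (z w : G F) : ℂ :=
  (1 / (M : ℂ)) * ∑ m ∈ Finset.Icc 1 M,
    (1 / ((ballE ϖ m ((1 : G F) : Vertex F)).ncard : ℂ)) *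
      ∫ u in (z • ballETilde ϖ m) ∩ (w • ballETilde ϖ m), a (DoubleCoset.mk Γ (K F) u) ∂μ

end Group

end PolytopalBalls

end

namespace PolytopalBalls

open ValuativeRel

/-! Vertices are homothety classes of lattices in `F³`. For dominant `v` the only effective facet of
`P_m` is `-3 v₂ ≤ 2m`, which says that `w` lies in `xE_m` exactly when `w` is represented by a
sublattice of colength at most `2m` in a lattice representing `x` (`mem_ballE_iff`). This turns
shapes of balls into statements about `HasColength`, which is bi-invariant under `K`, subadditive,
and at most doubles under inversion because the adjugate represents the inverse.

If two balls meet, then `g⁻¹h` and `h⁻¹g` both have colength at most `2m + 2·2m = 6m`, and these two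
bounds are the facets `-v₂ ≤ 2m` and `v₀ ≤ 2m` of `H_m`. Conversely, in an apartment containing `x`
and `y`, the intersection of suitably scaled lattices is a common point of the balls; the scaling is
`exists_shift_sum_posPart_le`.

For the kernel, the point of `H_m` farthest from the origin is `m(2,0,-2)`, at building distance
`√(3/2)·2√2·m = 2√3 m`. Beyond `2√3 M` every domain of integration is empty. -/

/-! ### Facet inequalities of the polytopes. -/

lemma latticePt_apply (l : Fin 3 → ℤ) (i : Fin 3) :
    latticePt l i = l i - (∑ j, (l j : ℝ)) / 3 := by
  have : latticePt l = WithLp.toLp 2 (fun i => (l i : ℝ) - (∑ j, (l j : ℝ)) / 3) := by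
    apply Submodule.eq_starProjection_of_mem_of_inner_eq_zero
    · change ∑ i, ((l i : ℝ) - (∑ j, (l j : ℝ)) / 3) = 0
      simp [Fin.sum_univ_three]; ring
    · intro w hw
      have hw : ∑ i, w i = 0 := hw
      simp [PiLp.inner_apply, Fin.sum_univ_three] at hw ⊢
      linear_combination (((l 0 : ℝ) + l 1 + l 2) / 3) * hw
  rw [this]

lemma mem_smul_convexHull_of_sum {E ι : Type*} [AddCommGroup E] [Module ℝ E] {s : Set E}
    (h0 : (0 : E) ∈ s) (I : Finset ι) (c : ι → ℝ) (p : ι → E) (hc : ∀ i ∈ I, 0 ≤ c i)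
    (hp : ∀ i ∈ I, p i ∈ s) {t : ℝ} (ht : ∑ i ∈ I, c i ≤ t) :
    ∑ i ∈ I, c i • p i ∈ t • convexHull ℝ s := by
  have hs := Finset.sum_nonneg hc
  rcases hs.eq_or_lt with h | h
  · have : ∑ i ∈ I, c i • p i = t • (0 : E) := by
      rw [smul_zero]
      refine Finset.sum_eq_zero fun i hi => ?_
      rw [(Finset.sum_eq_zero_iff_of_nonneg hc).1 h.symm i hi, zero_smul]
    rw [this]
    exact Set.smul_mem_smul_set (subset_convexHull ℝ s h0)
  · have ht0 : 0 < t := h.trans_le ht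
    rw [Set.mem_smul_set_iff_inv_smul_mem₀ ht0.ne', Finset.smul_sum]
    simp_rw [smul_smul]
    have hmem := (convex_convexHull ℝ s).centerMass_mem hc h
      (fun i hi => subset_convexHull ℝ s (hp i hi))
    have := (convex_convexHull ℝ s).smul_mem_of_zero_mem (subset_convexHull ℝ s h0) hmem
      (t := t⁻¹ * ∑ i ∈ I, c i) ⟨by positivity, by rw [inv_mul_le_one₀ ht0]; exact ht⟩
    rw [Finset.centerMass, smul_smul, mul_assoc, mul_inv_cancel₀ h.ne', mul_one,
      Finset.smul_sum] at this
    simpa [smul_smul] using this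

lemma le_of_mem_smul_convexHull {E : Type*} [AddCommGroup E] [Module ℝ E] {s : Set E}
    (f : E →ₗ[ℝ] ℝ) {C t : ℝ} (ht : 0 ≤ t) (hs : ∀ x ∈ s, f x ≤ C) {v : E}
    (hv : v ∈ t • convexHull ℝ s) : f v ≤ t * C := by
  obtain ⟨w, hw, rfl⟩ := hv
  have : w ∈ {x | f x ≤ C} := convexHull_min hs (convex_halfSpace_le f.isLinear C) hw
  simp only [map_smul, smul_eq_mul]
  exact mul_le_mul_of_nonneg_left this ht

lemma mem_smul_polytopeP_iff {t : ℝ} (ht : 0 ≤ t) {v : E3} (hv : ∑ i, v i = 0)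
    (h01 : v 1 ≤ v 0) (h12 : v 2 ≤ v 1) : v ∈ t • polytopeP ↔ -3 * v 2 ≤ 2 * t := by
  rw [Fin.sum_univ_three] at hv
  constructor
  · intro h
    have := le_of_mem_smul_convexHull (C := 2 / 3)
      (-(EuclideanSpace.proj (𝕜 := ℝ) (2 : Fin 3)).toLinearMap)
      ht (by rintro x (rfl | rfl | rfl) <;> simp <;> norm_num) h
    simp at this
    linarith
  · intro h
    have := mem_smul_convexHull_of_sum (s := {!₂[0, 0, 0], !₂[4 / 3, -2 / 3, -2 / 3],
      !₂[1 / 3, 1 / 3, -2 / 3]}) (Or.inl (by refine PiLp.ext fun i => ?_; fin_cases i <;> simp)) Finset.univ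
      -- The nonzero vertices of `P` are twice the first and once the second fundamental weight, so
      -- these are the coordinates of `v`. Their sum is `-3 v₂ / 2`.
      ![(v 0 - v 1) / 2, v 1 - v 2] ![(!₂[4 / 3, -2 / 3, -2 / 3] : E3), !₂[1 / 3, 1 / 3, -2 / 3]]
      (t := t) (by simp [Fin.forall_fin_two]; constructor <;> linarith)
      (by simp [Fin.forall_fin_two]) (by simp; linarith)
    refine (congrArg (· ∈ t • convexHull ℝ _) ?_).mpr this
    refine PiLp.ext fun i => ?_
    fin_cases i <;> simp <;> linarith

lemma mem_smul_polytopeH_iff {t : ℝ} (ht : 0 ≤ t) {v : E3} (hv : ∑ i, v i = 0)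
    (h01 : v 1 ≤ v 0) (h12 : v 2 ≤ v 1) :
    v ∈ t • polytopeH ↔ v 0 ≤ 2 * t ∧ -v 2 ≤ 2 * t := by
  rw [Fin.sum_univ_three] at hv
  constructor
  · intro h
    have h1 := le_of_mem_smul_convexHull (C := 2)
      (-(EuclideanSpace.proj (𝕜 := ℝ) (2 : Fin 3)).toLinearMap)
      ht (by rintro x (rfl | rfl | rfl | rfl) <;> simp) h
    have h2 := le_of_mem_smul_convexHull (C := 2)
      (EuclideanSpace.proj (𝕜 := ℝ) (0 : Fin 3)).toLinearMap
      ht (by rintro x (rfl | rfl | rfl | rfl) <;> simp) h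
    simp at h1 h2
    constructor <;> linarith
  · rintro ⟨h1, h2⟩
    have h0 : (0 : E3) ∈ ({!₂[0, 0, 0], !₂[2, -1, -1], !₂[2, 0, -2], !₂[1, 1, -2]} : Set E3) :=
      Or.inl (by refine PiLp.ext fun i => ?_; fin_cases i <;> simp)
    -- The diagonal through `(2, 0, -2)` cuts `H` into two triangles, separated by the sign of `v₁`.
    rcases le_total (v 1) 0 with h | h
    · have := mem_smul_convexHull_of_sum h0 Finset.univ
        ![-v 1, (v 1 - v 2) / 2] ![(!₂[2, -1, -1] : E3), !₂[2, 0, -2]]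
        (t := t) (by simp [Fin.forall_fin_two]; constructor <;> linarith)
        (by simp [Fin.forall_fin_two]) (by simp; linarith)
      refine (congrArg (· ∈ t • convexHull ℝ _) ?_).mpr this
      refine PiLp.ext fun i => ?_
      fin_cases i <;> simp <;> linarith
    · have := mem_smul_convexHull_of_sum h0 Finset.univ
        ![v 1, (v 0 - v 1) / 2] ![(!₂[1, 1, -2] : E3), !₂[2, 0, -2]]
        (t := t) (by simp [Fin.forall_fin_two]; constructor <;> linarith)
        (by simp [Fin.forall_fin_two]) (by simp; linarith)
      refine (congrArg (· ∈ t • convexHull ℝ _) ?_).mpr this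
      refine PiLp.ext fun i => ?_
      fin_cases i <;> simp <;> linarith

/-- The admissible `t` form a closed ray, so the infimum is attained and rounding it up loses
nothing against an integer `m`. -/
lemma polytopalNormCeil_polytopeH_le_iff (m : ℕ) {v : E3} (hv : ∑ i, v i = 0)
    (h01 : v 1 ≤ v 0) (h12 : v 2 ≤ v 1) :
    polytopalNormCeil polytopeH v ≤ (m : ℤ) ↔ v ∈ (m : ℝ) • polytopeH := by
  have : {t : ℝ | 0 ≤ t ∧ v ∈ t • polytopeH} = Set.Ici (max (v 0) (-v 2) / 2) := by
    rw [Fin.sum_univ_three] at hv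
    ext t
    simp only [Set.mem_ofPred_eq, Set.mem_Ici, div_le_iff₀ (zero_lt_two' ℝ), max_le_iff]
    constructor
    · rintro ⟨ht, h⟩
      rw [mem_smul_polytopeH_iff ht (by rwa [Fin.sum_univ_three]) h01 h12] at h
      constructor <;> linarith
    · rintro ⟨h1, h2⟩
      have ht : 0 ≤ t := by linarith
      exact ⟨ht, (mem_smul_polytopeH_iff ht (by rwa [Fin.sum_univ_three]) h01 h12).2
        ⟨by linarith, by linarith⟩⟩
  rw [mem_smul_polytopeH_iff m.cast_nonneg hv h01 h12, polytopalNormCeil, polytopalNorm, this,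
    csInf_Ici, Int.ceil_le, div_le_iff₀ (zero_lt_two' ℝ), max_le_iff]
  push_cast
  constructor <;> rintro ⟨h1, h2⟩ <;> constructor <;> linarith

/-! ### Smith normal form and the Cartan decomposition. -/

/-- Smith normal form over a discrete valuation ring. -/
lemma exists_smith_decomposition {R : Type*} [CommRing R] [IsDomain R] [IsDiscreteValuationRing R]
    {π : R} (hπ : Irreducible π) {d : ℕ} (A : Matrix (Fin d) (Fin d) R) (hA : A.det ≠ 0) :
    ∃ (P Q : GL (Fin d) R) (n : Fin d → ℕ), Antitone n ∧
      A = P.1 * Matrix.diagonal (fun i => π ^ n i) * Q.1 := by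
  have hinj : Function.Injective A.mulVecLin := by
    exact Matrix.mulVec_injective_of_det_ne_zero hA
  let e := LinearEquiv.ofInjective A.mulVecLin hinj
  let b := Pi.basisFun R (Fin d)
  obtain ⟨b', a, ab', hab⟩ := Submodule.exists_smith_normal_form_of_rank_eq (b := b)
    (N := LinearMap.range A.mulVecLin) e.symm.finrank_eq
  let c := b.map e
  have ha : ∀ i, a i ≠ 0 := fun i h => ab'.ne_zero i (Subtype.ext (by simp [hab, h]))
  choose n u hu using fun i => IsDiscreteValuationRing.eq_unit_mul_pow_irreducible (ha i) hπ
  -- Adapted bases of `R^d` and of the column span of `A` differ by the factors `a i`. Their units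
  -- are absorbed into the first basis, and sorting in the dual order makes the exponents decrease.
  let σ : Equiv.Perm (Fin d) := Tuple.sort fun i => OrderDual.toDual (n i)
  have hσ : Antitone (n ∘ σ) := Tuple.monotone_sort fun i => OrderDual.toDual (n i)
  let b₁ := (b'.unitsSMul u).reindex σ.symm
  let a₁ := ab'.reindex σ.symm
  have hab₁ : ∀ i, (a₁ i : Fin d → R) = π ^ n (σ i) • b₁ i := by
    intro i
    simp [a₁, b₁, hab, hu, Module.Basis.unitsSMul_apply, Units.smul_def, smul_smul, mul_comm]
  let := b.invertibleToMatrix b₁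
  let := a₁.invertibleToMatrix c
  refine ⟨unitOfInvertible (b.toMatrix b₁), unitOfInvertible (a₁.toMatrix c), n ∘ σ, hσ, ?_⟩
  ext i j
  have h1 : (c j : Fin d → R) = ∑ k, a₁.repr (c j) k • (a₁ k : Fin d → R) := by
    simpa only [Submodule.coe_sum, Submodule.coe_smul] using
      congrArg Subtype.val (a₁.sum_repr (c j)).symm
  have h2 : (c j : Fin d → R) i = A i j := by simp [c, e, b]
  rw [← h2, h1]
  simp [Matrix.mul_apply, Matrix.diagonal_apply, hab₁, Module.Basis.toMatrix_apply, b,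
    Finset.sum_apply]
  exact Finset.sum_congr rfl fun k _ => by ring

variable {F : Type*} [Field F]

section Torus

variable {ϖ : Fˣ}

/-- The diagonal matrix with entries `ϖ ^ l i`, as an element of `GL(3, F)`. -/
def diagGL (ϖ : Fˣ) (l : Fin 3 → ℤ) : GL (Fin 3) F :=
  Units.map (Matrix.diagonalRingHom (Fin 3) F).toMonoidHom
      (MulEquiv.piUnits.symm fun i => ϖ ^ l i)

lemma coe_diagGL (l : Fin 3 → ℤ) : (diagGL ϖ l : Matrix (Fin 3) (Fin 3) F) =
    Matrix.diagonal fun i => (ϖ : F) ^ l i := by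
  change Matrix.diagonal (fun i => ((ϖ ^ l i : Fˣ) : F)) = _
  simp

lemma torusElt_mul (l l' : Fin 3 → ℤ) :
    torusElt ϖ l * torusElt ϖ l' = torusElt ϖ (l + l') := by
  change Matrix.ProjGenLinGroup.mk (diagGL ϖ l) * Matrix.ProjGenLinGroup.mk (diagGL ϖ l') =
    Matrix.ProjGenLinGroup.mk (diagGL ϖ (l + l'))
  rw [← map_mul]
  congr 1
  refine Units.ext ?_
  rw [Units.val_mul, coe_diagGL, coe_diagGL, coe_diagGL, Matrix.diagonal_mul_diagonal]
  simp [zpow_add₀]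

lemma torusElt_const (c : ℤ) : torusElt ϖ (fun _ => c) = 1 := by
  change Matrix.ProjGenLinGroup.mk (diagGL ϖ _) = 1
  rw [← Matrix.ProjGenLinGroup.mk_scalar (ϖ ^ c)]
  congr 1

lemma torusElt_inv (l : Fin 3 → ℤ) : (torusElt ϖ l)⁻¹ = torusElt ϖ (-l) := by
  rw [inv_eq_iff_mul_eq_one, torusElt_mul, add_neg_cancel]
  exact torusElt_const 0

end Torus

variable [ValuativeRel F] {ϖ : Fˣ}

lemma mem_K_of_mk_map (A : GL (Fin 3) 𝒪[F]) :
    Matrix.ProjGenLinGroup.mk (Matrix.GeneralLinearGroup.map (algebraMap 𝒪[F] F) A) ∈ K F :=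
  ⟨A, rfl⟩

/-- The Cartan decomposition of `PGL(3, F)`. -/
lemma exists_cartan_decomposition [IsDiscreteValuationRing 𝒪[F]] {ϖ : Fˣ} (hϖ : IsUniformizer ϖ)
    (g : G F) :
    ∃ l : Fin 3 → ℤ, Antitone l ∧ ∃ k₁ ∈ K F, ∃ k₂ ∈ K F, g = k₁ * torusElt ϖ l * k₂ := by
  obtain ⟨π, hπ, hπϖ⟩ := hϖ
  induction g using Matrix.ProjGenLinGroup.induction_on with | mk g => ?_
  -- Dividing by an entry of largest valuation makes the matrix integral without changing its class
  -- in `PGL(3, F)`.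
  obtain ⟨⟨p, q⟩, hpq⟩ := Finite.exists_max fun x : Fin 3 × Fin 3 => valuation F (g x.1 x.2)
  set c : F := g p q with hc
  have hc0 : c ≠ 0 := by
    intro h0
    have h : ∀ i j, g i j = 0 := fun i j => by
      have := hpq (i, j)
      simpa [← hc, h0] using this
    have : (g : Matrix (Fin 3) (Fin 3) F) = 0 := by ext i j; exact h i j
    exact g.ne_zero this
  have hint : ∀ i j, g i j / c ∈ 𝒪[F] := fun i j => by
    rw [Valuation.mem_integer_iff, map_div₀]
    exact div_le_one_of_le₀ (hpq (i, j)) zero_le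
  let A : Matrix (Fin 3) (Fin 3) 𝒪[F] := fun i j => ⟨g i j / c, hint i j⟩
  have hAg : A.map (algebraMap 𝒪[F] F) = c⁻¹ • (g : Matrix (Fin 3) (Fin 3) F) := by
    ext i j
    exact div_eq_inv_mul (g i j) c
  have hA : A.det ≠ 0 := by
    intro h
    have h1 : (A.map (algebraMap 𝒪[F] F)).det = 0 := by
      rw [← RingHom.mapMatrix_apply, ← RingHom.map_det, h, map_zero]
    rw [hAg, Matrix.det_smul] at h1
    have := (Matrix.isUnits_det_units g).ne_zero
    simp_all
  obtain ⟨P, Q, n, hn, hPQ⟩ := exists_smith_decomposition hπ A hA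
  refine ⟨fun i => n i, fun i j hij => Int.ofNat_le.2 (hn hij), _, mem_K_of_mk_map P, _,
    mem_K_of_mk_map Q, ?_⟩
  rw [torusElt, ← map_mul, ← map_mul, Matrix.ProjGenLinGroup.mk_eq_mk_iff]
  refine ⟨(Units.mk0 c hc0)⁻¹, Units.ext ?_⟩
  have h3 := congrArg (fun B : Matrix (Fin 3) (Fin 3) 𝒪[F] => B.map (algebraMap 𝒪[F] F)) hPQ
  simp only [Matrix.map_mul, hAg, Matrix.diagonal_map (map_zero _)] at h3
  rw [Units.val_mul, Units.val_mul, Units.val_mul, Matrix.GeneralLinearGroup.coe_scalar]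
  change g.1 * Matrix.diagonal (fun _ => ((Units.mk0 c hc0)⁻¹ : Fˣ).1) = P.1.map (algebraMap 𝒪[F] F) *
    Matrix.diagonal (fun i => ((ϖ ^ (n i : ℤ) : Fˣ) : F)) * Q.1.map (algebraMap 𝒪[F] F)
  have hπn : (fun i => ((ϖ ^ (n i : ℤ) : Fˣ) : F)) = fun i => algebraMap 𝒪[F] F (π ^ n i) := by
    ext i
    rw [map_pow, zpow_natCast, Units.val_pow_eq_pow_val, ← hπϖ]
    rfl
  rw [hπn, ← h3, ← Matrix.smul_one_eq_diagonal, Matrix.mul_smul, mul_one]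
  simp

/-! ### Colength in `PGL(3, F)`. -/

variable (ϖ : Fˣ) in
/-- An element of `PGL(3, F)` has colength at most `N` if it has an integral representative whose
determinant has valuation at most `N`. -/
def HasColength (N : ℕ) (g : G F) : Prop :=
  ∃ A : GL (Fin 3) F, Matrix.ProjGenLinGroup.mk A = g ∧ (∀ i j, A i j ∈ 𝒪[F]) ∧
    valuation F ϖ ^ N ≤ valuation F (A : Matrix (Fin 3) (Fin 3) F).det

lemma HasColength.mul {N N' : ℕ} {g g' : G F} (hg : HasColength ϖ N g)
    (hg' : HasColength ϖ N' g') : HasColength ϖ (N + N') (g * g') := by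
  obtain ⟨A, rfl, hA, hA'⟩ := hg
  obtain ⟨B, rfl, hB, hB'⟩ := hg'
  refine ⟨A * B, map_mul _ _ _, fun i j => ?_, ?_⟩
  · rw [Units.val_mul, Matrix.mul_apply]
    exact sum_mem fun k _ => mul_mem (hA i k) (hB k j)
  · rw [Units.val_mul, Matrix.det_mul, map_mul, pow_add]
    exact mul_le_mul' hA' hB'

/-- The adjugate of an integral representative is integral, represents the inverse, and has
determinant `det²` in size 3. -/
lemma HasColength.inv {N : ℕ} {g : G F} (hg : HasColength ϖ N g) :
    HasColength ϖ (2 * N) g⁻¹ := by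
  obtain ⟨A, rfl, hA, hA'⟩ := hg
  have hadj : ((A⁻¹ * Matrix.GeneralLinearGroup.scalar (Fin 3) A.det : GL (Fin 3) F) :
      Matrix (Fin 3) (Fin 3) F) = (A : Matrix (Fin 3) (Fin 3) F).adjugate := by
    rw [Units.val_mul, Matrix.coe_units_inv, Matrix.inv_def, Matrix.GeneralLinearGroup.coe_scalar,
      Matrix.scalar_apply, ← Matrix.smul_one_eq_diagonal, Matrix.mul_smul, mul_one, smul_smul,
      Matrix.GeneralLinearGroup.val_det_apply,
      Ring.mul_inverse_cancel _ (Matrix.isUnits_det_units A), one_smul]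
  refine ⟨A⁻¹ * Matrix.GeneralLinearGroup.scalar (Fin 3) A.det, by simp, ?_, ?_⟩
  · intro i j
    rw [hadj]
    let B : Matrix (Fin 3) (Fin 3) 𝒪[F] := fun i j => ⟨A i j, hA i j⟩
    have hB : (A : Matrix (Fin 3) (Fin 3) F) = (algebraMap 𝒪[F] F).mapMatrix B := rfl
    rw [hB, ← RingHom.map_adjugate]
    exact (B.adjugate i j).2
  · rw [hadj, Matrix.det_adjugate, map_pow, Fintype.card_fin, mul_comm, pow_mul]
    exact pow_le_pow_left' hA' 2

lemma hasColength_zero_of_mem_K {k : G F} (hk : k ∈ K F) : HasColength ϖ 0 k := by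
  obtain ⟨A, rfl⟩ := hk
  refine ⟨_, rfl, fun i j => (A i j).2, ?_⟩
  rw [pow_zero]
  have h : ((Matrix.GeneralLinearGroup.map (algebraMap 𝒪[F] F) A : GL (Fin 3) F) :
      Matrix (Fin 3) (Fin 3) F) = (algebraMap 𝒪[F] F).mapMatrix A.1 := rfl
  rw [h, ← RingHom.map_det,
    (Valuation.integer.integers (valuation F)).one_of_isUnit (Matrix.isUnits_det_units A)]

lemma hasColength_mul_mem_K_iff {N : ℕ} {g k₁ k₂ : G F} (h₁ : k₁ ∈ K F) (h₂ : k₂ ∈ K F) :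
    HasColength ϖ N (k₁ * g * k₂) ↔ HasColength ϖ N g := by
  refine ⟨fun h => ?_, fun h => ?_⟩
  · simpa [mul_assoc] using ((hasColength_zero_of_mem_K (inv_mem h₁)).mul h).mul
      (hasColength_zero_of_mem_K (inv_mem h₂))
  · simpa using ((hasColength_zero_of_mem_K h₁).mul h).mul (hasColength_zero_of_mem_K h₂)

lemma valuation_det_diagGL (l : Fin 3 → ℤ) :
    valuation F (diagGL ϖ l : Matrix (Fin 3) (Fin 3) F).det = valuation F ϖ ^ ∑ i, l i := by
  have h0 : (valuation F ϖ) ≠ 0 := by simp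
  simp [coe_diagGL, Matrix.det_diagonal, Fin.prod_univ_three, Fin.sum_univ_three, zpow_add₀ h0]

lemma hasColength_torusElt_of_nonneg {l : Fin 3 → ℤ} (hϖ : valuation F ϖ < 1)
    (hl : ∀ i, 0 ≤ l i) {N : ℕ} (hN : ∑ i, l i ≤ N) : HasColength ϖ N (torusElt ϖ l) := by
  refine ⟨diagGL ϖ l, rfl, fun i j => ?_, ?_⟩
  · rw [coe_diagGL, Matrix.diagonal_apply]
    split_ifs
    · lift l i to ℕ using hl i with n
      rw [zpow_natCast]
      exact pow_mem (show (ϖ : F) ∈ 𝒪[F] from hϖ.le) n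
    · exact zero_mem _
  · have h0 : (valuation F ϖ) ≠ 0 := by simp
    rw [valuation_det_diagGL, ← zpow_natCast]
    exact (zpow_le_zpow_iff_right_of_lt_one₀ (zero_lt_iff.2 h0) hϖ).2 hN

/-- The most economical integral representative scales the smallest exponent to `0`, leaving
determinant exponent `∑ l j - 3 min l`. For any other scalar `u`, integrality of `ϖ^(l i) u`, cubed,
bounds the determinant. -/
lemma hasColength_torusElt_iff (hϖ : valuation F ϖ < 1) (l : Fin 3 → ℤ) (N : ℕ) :
    HasColength ϖ N (torusElt ϖ l) ↔ ∀ i, ∑ j, l j - 3 * l i ≤ N := by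
  have h0 : (valuation F ϖ) ≠ 0 := by simp
  constructor
  · rintro ⟨A, hA, hA', hdet⟩ i
    obtain ⟨u, rfl⟩ := Matrix.ProjGenLinGroup.mk_eq_mk_iff.1 hA.symm
    change ∀ i j, (diagGL ϖ l * Matrix.GeneralLinearGroup.scalar (Fin 3) u : GL (Fin 3) F) i j ∈
      𝒪[F] at hA'
    change _ ≤ valuation F
      (diagGL ϖ l * Matrix.GeneralLinearGroup.scalar (Fin 3) u : GL (Fin 3) F).1.det at hdet
    have h1 := hA' i i
    have h2 : valuation F ϖ ^ l i * valuation F u ≤ 1 := by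
      simpa [coe_diagGL, Matrix.GeneralLinearGroup.coe_scalar, Valuation.mem_integer_iff] using h1
    rw [Units.val_mul, Matrix.det_mul, map_mul, valuation_det_diagGL,
      Matrix.GeneralLinearGroup.coe_scalar, Matrix.scalar_apply, Matrix.det_diagonal,
      Finset.prod_const, Finset.card_univ, Fintype.card_fin, map_pow] at hdet
    have h3 : valuation F ϖ ^ (∑ j, l j) * valuation F u ^ 3 ≤
        valuation F ϖ ^ (∑ j, l j - 3 * l i) := by
      calc _ = valuation F ϖ ^ (∑ j, l j - 3 * l i) * (valuation F ϖ ^ l i * valuation F u) ^ 3 := by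
            rw [mul_pow, ← mul_assoc, ← zpow_natCast (valuation F ϖ ^ l i), ← zpow_mul,
              ← zpow_add₀ h0]
            congr 2
            push_cast
            ring
        _ ≤ _ := mul_le_of_le_one_right' (pow_le_one' h2 3)
    have h4 := hdet.trans h3
    rw [← zpow_natCast] at h4
    exact (zpow_le_zpow_iff_right_of_lt_one₀ (zero_lt_iff.2 h0) hϖ).1 h4
  · intro h
    obtain ⟨i, hi⟩ := Finite.exists_min l
    have : torusElt ϖ l = torusElt ϖ (l + fun _ => - l i) := by
      rw [← torusElt_mul, torusElt_const, mul_one]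
    rw [this]
    refine hasColength_torusElt_of_nonneg hϖ (fun j => by simpa using hi j) ?_
    have := h i
    simp [Fin.sum_univ_three] at this ⊢
    linarith

/-- The shift subtracts the mean of `l` rounded to the nearest integer, so the shifted entries sum
to `-1`, `0` or `1`. The rounding costs at most `2/3` in each bound, which integrality absorbs. -/
lemma exists_shift_sum_posPart_le {l : Fin 3 → ℤ} {m : ℕ} (h₁ : ∀ i, ∑ j, l j - 3 * l i ≤ 6 * m)
    (h₂ : ∀ i, 3 * l i - ∑ j, l j ≤ 6 * m) :
    ∃ c, ∑ i, max (l i + c) 0 ≤ 2 * (m : ℤ) ∧ ∑ i, max (-(l i + c)) 0 ≤ 2 * (m : ℤ) := by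
  refine ⟨-((∑ j, l j + 1) / 3), ?_⟩
  simp only [Fin.forall_fin_succ, Fin.sum_univ_three] at h₁ h₂ ⊢
  simp at h₁ h₂
  omega

lemma IsUniformizer.valuation_lt_one (hϖ : IsUniformizer ϖ) : valuation F ϖ < 1 := by
  obtain ⟨π, hπ, hπϖ⟩ := hϖ
  rw [← hπϖ]
  refine lt_of_le_of_ne π.2 fun h => hπ.not_isUnit ?_
  have h0 : (algebraMap 𝒪[F] F π) ≠ 0 := fun h0 => by
    rw [show (π : F) = 0 from h0, map_zero] at h
    exact zero_ne_one h
  exact (Valuation.integer.integers (valuation F)).isUnit_of_one h0.isUnit h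

variable [IsDiscreteValuationRing 𝒪[F]]

/-! ### Balls, their intersections and distances. -/

/-- The Weyl chamber-valued distance is realized by a Cartan decomposition. -/
lemma exists_dAplus_eq (hϖ : IsUniformizer ϖ) (g h : G F) :
    ∃ l : Fin 3 → ℤ, Antitone l ∧ dAplus ϖ (g : Vertex F) (h : Vertex F) = latticePt l ∧
      ∃ k₁ ∈ K F, ∃ k₂ ∈ K F, g⁻¹ * h = k₁ * torusElt ϖ l * k₂ := by
  have hex : ∃ v, HasRelPos ϖ (g : Vertex F) (h : Vertex F) v := by
    obtain ⟨l, hl, k₁, hk₁, k₂, hk₂, e⟩ := exists_cartan_decomposition hϖ (g⁻¹ * h)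
    exact ⟨_, l, hl, rfl, g, h, rfl, rfl, k₁, hk₁, k₂, hk₂, e⟩
  -- Existence suffices: uniqueness is never needed, since the chosen distance is only tested
  -- through `HasColength` or through one realization.
  obtain ⟨l, hl, hv, g', h', hg, hh, k₁, hk₁, k₂, hk₂, e⟩ := Classical.epsilon_spec hex
  refine ⟨l, hl, hv.symm, g⁻¹ * g' * k₁, mul_mem ?_ hk₁, k₂ * (h'⁻¹ * h),
    mul_mem hk₂ (QuotientGroup.eq.1 hh), ?_⟩
  · exact QuotientGroup.eq.1 hg.symm
  · calc g⁻¹ * h = g⁻¹ * g' * (g'⁻¹ * h') * (h'⁻¹ * h) := by group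
      _ = _ := by rw [e]; group

lemma sum_latticePt (l : Fin 3 → ℤ) : ∑ i, latticePt l i = 0 := by
  simp only [latticePt_apply, Fin.sum_univ_three]
  ring

lemma latticePt_le {l : Fin 3 → ℤ} (hl : Antitone l) {i j : Fin 3} (hij : i ≤ j) :
    latticePt l j ≤ latticePt l i := by
  have : (l j : ℝ) ≤ l i := Int.cast_le.2 (hl hij)
  simp only [latticePt_apply]
  linarith

lemma mem_ballE_iff (hϖ : IsUniformizer ϖ) (m : ℕ) (g h : G F) :
    (h : Vertex F) ∈ ballE ϖ m (g : Vertex F) ↔ HasColength ϖ (2 * m) (g⁻¹ * h) := by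
  obtain ⟨l, hl, hd, k₁, hk₁, k₂, hk₂, e⟩ := exists_dAplus_eq hϖ g h
  rw [e, hasColength_mul_mem_K_iff hk₁ hk₂, hasColength_torusElt_iff hϖ.valuation_lt_one]
  have hL : latticePt l ∈ Lam := ⟨l, rfl⟩
  change dAplus ϖ (g : Vertex F) (h : Vertex F) ∈ _ ∧ dAplus ϖ (g : Vertex F) (h : Vertex F) ∈ _ ↔ _
  rw [hd, and_iff_left hL, mem_smul_polytopeP_iff m.cast_nonneg (sum_latticePt l)
    (latticePt_le hl (by decide)) (latticePt_le hl (by decide)), latticePt_apply]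
  have h01 := hl (show (0 : Fin 3) ≤ 1 by decide)
  have h12 := hl (show (1 : Fin 3) ≤ 2 by decide)
  have hcast : -3 * ((l 2 : ℝ) - (∑ j, (l j : ℝ)) / 3) ≤ 2 * m ↔
      ∑ j, l j - 3 * l 2 ≤ ((2 * m : ℕ) : ℤ) := by
    rw [← Int.cast_le (R := ℝ)]
    push_cast
    constructor <;> intro h <;> linarith
  rw [hcast]
  refine ⟨fun h i => ?_, fun h => h 2⟩
  fin_cases i <;> simp at h ⊢ <;> linarith

lemma dAplus_mem_smul_polytopeH_iff (hϖ : IsUniformizer ϖ) (m : ℕ) (g h : G F) :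
    dAplus ϖ (g : Vertex F) (h : Vertex F) ∈ (m : ℝ) • polytopeH ↔
      HasColength ϖ (6 * m) (g⁻¹ * h) ∧ HasColength ϖ (6 * m) (h⁻¹ * g) := by
  obtain ⟨l, hl, hd, k₁, hk₁, k₂, hk₂, e⟩ := exists_dAplus_eq hϖ g h
  have e' : h⁻¹ * g = k₂⁻¹ * torusElt ϖ (-l) * k₁⁻¹ := by
    rw [← torusElt_inv, ← mul_inv_rev, ← mul_inv_rev, ← mul_assoc, ← e]
    group
  rw [e, e', hasColength_mul_mem_K_iff hk₁ hk₂,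
    hasColength_mul_mem_K_iff (inv_mem hk₂) (inv_mem hk₁),
    hasColength_torusElt_iff hϖ.valuation_lt_one, hasColength_torusElt_iff hϖ.valuation_lt_one, hd,
    mem_smul_polytopeH_iff m.cast_nonneg (sum_latticePt l)
    (latticePt_le hl (by decide)) (latticePt_le hl (by decide)), latticePt_apply, latticePt_apply]
  have h01 := hl (show (0 : Fin 3) ≤ 1 by decide)
  have h12 := hl (show (1 : Fin 3) ≤ 2 by decide)
  have hcast : -((l 2 : ℝ) - (∑ j, (l j : ℝ)) / 3) ≤ 2 * m ↔
      ∑ j, l j - 3 * l 2 ≤ ((6 * m : ℕ) : ℤ) := by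
    rw [← Int.cast_le (R := ℝ)]
    push_cast
    constructor <;> intro h <;> linarith
  have hcast' : (l 0 : ℝ) - (∑ j, (l j : ℝ)) / 3 ≤ 2 * m ↔
      ∑ j, (-l) j - 3 * (-l) 0 ≤ ((6 * m : ℕ) : ℤ) := by
    rw [← Int.cast_le (R := ℝ)]
    simp only [Pi.neg_apply, Finset.sum_neg_distrib]
    push_cast
    constructor <;> intro h <;> linarith
  rw [hcast, hcast', and_comm]
  refine and_congr ⟨fun h i => ?_, fun h => h 2⟩ ⟨fun h i => ?_, fun h => h 0⟩ <;>
  fin_cases i <;> simp at h ⊢ <;> linarith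

lemma ballE_inter_ballE_nonempty_iff (hϖ : IsUniformizer ϖ) (m : ℕ) (g h : G F) :
    (ballE ϖ m (g : Vertex F) ∩ ballE ϖ m (h : Vertex F)).Nonempty ↔
      dAplus ϖ (g : Vertex F) (h : Vertex F) ∈ (m : ℝ) • polytopeH := by
  rw [dAplus_mem_smul_polytopeH_iff hϖ]
  constructor
  · rintro ⟨w, hg, hh⟩
    induction w using QuotientGroup.induction_on with | H u => ?_
    rw [mem_ballE_iff hϖ] at hg hh
    constructor
    -- `g⁻¹h = (g⁻¹u)(h⁻¹u)⁻¹`, and inversion doubles the second bound.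
    · convert hg.mul hh.inv using 1
      · ring
      · group
    · convert hh.mul hg.inv using 1
      · ring
      · group
  · rintro ⟨h₁, h₂⟩
    obtain ⟨l, hl, k₁, hk₁, k₂, hk₂, e⟩ := exists_cartan_decomposition hϖ (g⁻¹ * h)
    have e' : h⁻¹ * g = k₂⁻¹ * torusElt ϖ (-l) * k₁⁻¹ := by
      rw [← torusElt_inv, ← mul_inv_rev, ← mul_inv_rev, ← mul_assoc, ← e]
      group
    rw [e, hasColength_mul_mem_K_iff hk₁ hk₂, hasColength_torusElt_iff hϖ.valuation_lt_one] at h₁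
    rw [e', hasColength_mul_mem_K_iff (inv_mem hk₂) (inv_mem hk₁),
      hasColength_torusElt_iff hϖ.valuation_lt_one] at h₂
    obtain ⟨c, hc₁, hc₂⟩ := exists_shift_sum_posPart_le (l := l) (m := m)
      (fun i => by simpa using h₁ i)
      (fun i => by have := h₂ i; simp at this; linarith)
    -- In the apartment of `g k₁`, entrywise maximum of exponents is intersection of lattices. Seen
    -- from `g` and from `h` it has the positive and negative parts of `l + c` as exponents.
    refine ⟨((g * k₁ * torusElt ϖ (fun i => max (l i + c) 0) : G F) : Vertex F), ?_, ?_⟩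
    · rw [mem_ballE_iff hϖ]
      have : g⁻¹ * (g * k₁ * torusElt ϖ fun i => max (l i + c) 0) =
          k₁ * (torusElt ϖ fun i => max (l i + c) 0) * 1 := by group
      rw [this, hasColength_mul_mem_K_iff hk₁ (one_mem _)]
      exact hasColength_torusElt_of_nonneg hϖ.valuation_lt_one (fun i => le_max_right _ _)
        (by exact_mod_cast hc₁)
    · rw [mem_ballE_iff hϖ]
      have : h⁻¹ * (g * k₁ * torusElt ϖ fun i => max (l i + c) 0) =
          k₂⁻¹ * (torusElt ϖ fun i => max (-(l i + c)) 0) * 1 := by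
        have h3 : (fun i => max (-(l i + c)) 0) =
            -l + (fun i => max (l i + c) 0) + fun _ => -c := by
          ext i
          simp only [Pi.add_apply, Pi.neg_apply]
          omega
        rw [h3, ← torusElt_mul, torusElt_const, ← torusElt_mul, mul_assoc g, ← mul_assoc, e']
        group
      rw [this, hasColength_mul_mem_K_iff (inv_mem hk₂) (one_mem _)]
      exact hasColength_torusElt_of_nonneg hϖ.valuation_lt_one (fun i => le_max_right _ _)
        (by exact_mod_cast hc₂)

lemma polytopalNormCeil_dAplus_le_iff (hϖ : IsUniformizer ϖ) (m : ℕ) (g h : G F) :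
    polytopalNormCeil polytopeH (dAplus ϖ (g : Vertex F) (h : Vertex F)) ≤ (m : ℤ) ↔
      dAplus ϖ (g : Vertex F) (h : Vertex F) ∈ (m : ℝ) • polytopeH := by
  obtain ⟨l, hl, hd, -⟩ := exists_dAplus_eq hϖ g h
  rw [hd]
  exact polytopalNormCeil_polytopeH_le_iff m (sum_latticePt l) (latticePt_le hl (by decide))
    (latticePt_le hl (by decide))

lemma norm_latticePt_le_of_mem_smul_polytopeH {l : Fin 3 → ℤ} (hl : Antitone l) {t : ℝ} (ht : 0 ≤ t)
    (h : latticePt l ∈ t • polytopeH) : √(3 / 2) * ‖latticePt l‖ ≤ 2 * √3 * t := by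
  have h01 := latticePt_le hl (show (0 : Fin 3) ≤ 1 by decide)
  have h12 := latticePt_le hl (show (1 : Fin 3) ≤ 2 by decide)
  have hsum := sum_latticePt l
  rw [mem_smul_polytopeH_iff ht hsum h01 h12] at h
  obtain ⟨h0, h2⟩ := h
  rw [Fin.sum_univ_three] at hsum
  have hr : 2 * √3 * t = √(12 * t ^ 2) := by
    rw [show 12 * t ^ 2 = (2 * t) ^ 2 * 3 by ring, Real.sqrt_mul (by positivity),
      Real.sqrt_sq (by positivity)]
    ring
  rw [EuclideanSpace.norm_eq, ← Real.sqrt_mul (by norm_num), hr]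
  refine Real.sqrt_le_sqrt ?_
  simp only [Fin.sum_univ_three, Real.norm_eq_abs, sq_abs]
  have h1 : latticePt l 1 = -latticePt l 0 - latticePt l 2 := by linarith
  rw [h1] at h01 h12 ⊢
  -- With `a = v₀` and `b = -v₂` the claim is `a² + b² - ab ≤ 4t²`, with equality at the vertex `a =
  -- b = 2t`.
  nlinarith [mul_nonneg (sub_nonneg.2 h0) (sub_nonneg.2 h01),
    mul_nonneg (sub_nonneg.2 h2) (sub_nonneg.2 h12),
    mul_nonneg (sub_nonneg.2 h0) (sub_nonneg.2 h2)]

/-- An upper bound on the infimum needs only one apartment containing both vertices, and the Cartan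
decomposition supplies it. -/
lemma vertexDist_le (hϖ : IsUniformizer ϖ) {t : ℝ} (ht : 0 ≤ t) {g h : G F}
    (hd : dAplus ϖ (g : Vertex F) (h : Vertex F) ∈ t • polytopeH) :
    vertexDist ϖ (g : Vertex F) (h : Vertex F) ≤ 2 * √3 * t := by
  obtain ⟨l, hl, hd', k₁, hk₁, k₂, hk₂, e⟩ := exists_dAplus_eq hϖ g h
  rw [hd'] at hd
  refine le_trans ?_ (norm_latticePt_le_of_mem_smul_polytopeH hl ht hd)
  refine csInf_le ⟨0, ?_⟩ ⟨g * k₁, 0, l, ?_, ?_, ?_⟩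
  · rintro _ ⟨_, _, _, _, _, rfl⟩
    positivity
  · rw [show torusElt ϖ 0 = 1 from torusElt_const 0, mul_one]
    exact QuotientGroup.eq.2 (by simpa using hk₁)
  · refine QuotientGroup.eq.2 ?_
    have : (g * k₁ * torusElt ϖ l)⁻¹ * h = k₂ := by
      rw [mul_inv_rev, mul_inv_rev, mul_assoc, mul_assoc, e]
      group
    rwa [this]
  · have : latticePt 0 = 0 := PiLp.ext fun i => by simp [latticePt_apply]
    rw [this, dist_zero_left]

end PolytopalBalls

open PolytopalBalls

theorem mainTheorem6 (F : Type*) [Field F] [CharZero F] [ValuativeRel F] [TopologicalSpace F]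
    [IsNonarchimedeanLocalField F] (ϖ : Fˣ) (hϖ : PolytopalBalls.IsUniformizer ϖ) :
    (∀ (m : ℕ) (x y : PolytopalBalls.Vertex F),
      ((PolytopalBalls.ballE ϖ m x ∩ PolytopalBalls.ballE ϖ m y).Nonempty ↔
        PolytopalBalls.dAplus ϖ x y ∈
          PolytopalBalls.dilateLattice PolytopalBalls.polytopeH (m : ℝ)) ∧
      ((PolytopalBalls.ballE ϖ m x ∩ PolytopalBalls.ballE ϖ m y).Nonempty ↔
        PolytopalBalls.polytopalNormCeil PolytopalBalls.polytopeH
          (PolytopalBalls.dAplus ϖ x y) ≤ (m : ℤ))) ∧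
    (∀ (μ : MeasureTheory.Measure (PolytopalBalls.G F)) [μ.IsHaarMeasure],
      μ (PolytopalBalls.K F : Set (PolytopalBalls.G F)) = 1 →
      ∀ (Γ : Subgroup (PolytopalBalls.G F))
        (a : DoubleCoset.Quotient (Γ : Set (PolytopalBalls.G F))
          (PolytopalBalls.K F : Set (PolytopalBalls.G F)) → ℂ)
        (M : ℕ), 0 < M → ∀ z w : PolytopalBalls.G F,
        2 * √3 * (M : ℝ) <
          PolytopalBalls.vertexDist ϖ (z : PolytopalBalls.Vertex F) (w : PolytopalBalls.Vertex F) →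
        PolytopalBalls.kernelL ϖ μ Γ a M z w = 0) := by
  refine ⟨fun m x y => ?_, fun μ _ _ Γ a M _ z w hzw => ?_⟩
  · induction x using QuotientGroup.induction_on with | H g => ?_
    induction y using QuotientGroup.induction_on with | H h => ?_
    have hL : dAplus ϖ (g : Vertex F) (h : Vertex F) ∈ Lam := by
      obtain ⟨l, -, hd, -⟩ := exists_dAplus_eq hϖ g h
      exact hd ▸ ⟨l, rfl⟩
    exact ⟨(ballE_inter_ballE_nonempty_iff hϖ m g h).trans (and_iff_left hL).symm,
      (ballE_inter_ballE_nonempty_iff hϖ m g h).trans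
        (polytopalNormCeil_dAplus_le_iff hϖ m g h).symm⟩
  · refine mul_eq_zero_of_right _ (Finset.sum_eq_zero fun m hm => ?_)
    suffices h : (z • ballETilde ϖ m) ∩ (w • ballETilde ϖ m) = ∅ by
      rw [h, Measure.restrict_empty, integral_zero_measure, mul_zero]
    by_contra hne
    obtain ⟨u, hu, hu'⟩ := Set.nonempty_iff_ne_empty.2 hne
    -- Left translation carries the ball at `1K` to the ball at `gK`, because membership depends
    -- only on `g⁻¹u`.
    have key : ∀ g : G F, u ∈ g • ballETilde ϖ m → (u : Vertex F) ∈ ballE ϖ m (g : Vertex F) := by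
      intro g hg
      have := (mem_ballE_iff hϖ m 1 (g⁻¹ * u)).1 (Set.mem_smul_set_iff_inv_smul_mem.1 hg)
      rw [mem_ballE_iff hϖ]
      simpa using this
    have hd := vertexDist_le hϖ m.cast_nonneg
      ((ballE_inter_ballE_nonempty_iff hϖ m z w).1 ⟨u, key z hu, key w hu'⟩)
    have hmM : (m : ℝ) ≤ M := Nat.cast_le.2 (Finset.mem_Icc.1 hm).2
    exact absurd hzw (not_lt.2 (hd.trans (mul_le_mul_of_nonneg_left hmM (by positivity))))
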